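/- Let $(\Omega,\mathcal F)$ be a measurable space with a $\sigma$-finite (positive) measure $\mu$, and let $\mu^n$ be the product measure on $(\Omega^n,\mathcal F^n)$. **Notation.** For a signed measure $\sigma$ put $\|\sigma\|_{TV}=\frac12\bigl[\sup_A\sigma(A)-\inf_A\sigma(A)\bigr]$, with $A$ ranging over the measurable sets. Let $d_{\mathrm{Ham}}(x,y)=\sum_{i=1}^n 1_{x_i\ne y_i}$ on $\Omega^n$. For $f\in L_1(\mu^n)$ put $(\pi f)(x_2,\dots,x_n)=\int_\Omega f(x_1,x_2,\dots,x_n)\,d\mu(x_1)$, and define recursively $\Psi_0=0$, $\Psi_n(f)=\Psi_{n-1}(\pi f)+\int_{\Omega^n}\max(f,0)\,d\mu^n$. Let $\Phi_n\subset L_1(\mu^n)$ be the set of measurable $g:\Omega^n\to[0,\operatorname{diam}_{\mathrm{Ham}}(\Omega^n)]$ with $|g(x)-g(y)|\le d_{\mathrm{Ham}}(x,y)$ for all $x,y$. The space $(\Omega^n,d_{\mathrm{Ham}})$ is *$\Psi$-dominated* with respect to $\mu$ if $\sup_{g\in\Phi_n}\int fg\,d\mu^n\le\Psi_n(f)$ for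 all $f\in L_1(\mu^n)$. For a probability measure $Q\ll\mu^n$ on $\Omega^n$, let $X=(X_1,\dots,X_n)$ have law $Q$, let $p_i$ be the density of $(X_1,\dots,X_i)$ with respect to $\mu^i$, and, for $i<j$ and $p_i(x)>0$, let $\mathcal L(X_j^n\mid X_1^i=x)$ be the conditional law of $(X_j,\dots,X_n)$ obtained from the density $dQ/d\mu^n$. For $y\in\Omega^{i-1}$, $w,w'\in\Omega$ put $$\eta_{ij}(y,w,w')=\bigl\|\mathcal L(X_j^n\mid X_1^i=yw)-\mathcal L(X_j^n\mid X_1^i=yw')\bigr\|_{TV},$$ and let $\bar\eta_{ij}$ be the essential supremum of $\eta_{ij}$ with respect to $\mu^{i-1}\otimes\mu\otimes\mu$ over the set of $(y,w,w')$ with $p_i(yw)>0$ and $p_i(yw')>0$. The *$\eta$-mixing matrix* $\Delta_n(Q)$ is the upper triangular $n\times n$ matrix with $1$ on the diagonal and entries $\bar\eta_{ij}$ for $i<j$, and $\|\Delta_n(Q)\|_\infty$ is its $\ell_\infty$ operator norm (the maximal absolute row sum). **Theorem.** Suppose that $(\Omega^n,d_{\mathrm{Ham}})$ is $\Psi$-dominated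 with respect to $\mu$ for every $n\ge1$. Let $P$ be a probability measure on $(\Omega^{\mathbb N},\mathcal F^{\mathbb N})$, the law of a process $(X_i)_{i\ge1}$, such that for every $n\ge1$ the law $P_n$ of $(X_1,\dots,X_n)$ satisfies $P_n\ll\mu^n$. Let $\hat P_n(A)=\frac1n\sum_{i=1}^n 1_{X_i\in A}$, and let $\nu$ be a finite measure on $(\Omega,\mathcal F)$ with $$\lim_{n\to\infty}\bigl\|\mathbf E\hat P_n(\cdot)-\nu(\cdot)\bigr\|_{TV}=0 .$$ Write $\Delta_n=\Delta_n(P_n)$. 1. If $\varepsilon$ and $n_0=n_0(\varepsilon)$ are such that $\|\mathbf E\hat P_n(\cdot)-\nu(\cdot)\|_{TV}<\varepsilon$ for all $n>n_0$, then for all $n>n_0$, all $t>0$ and all $A\in\mathcal F$, $$P_n\bigl(|\hat P_n(A)-\nu(A)|>t+\varepsilon\bigr)\le 2\exp\!\Bigl(-\frac{n t^2}{2\|\Delta_n\|_\infty^2}\Bigr).$$ 2. If moreover $\sum_n\exp\bigl(-nt^2/(2\|\Delta_n\|_\infty^2)\bigr)<\infty$ for every $t>0$ (in particular, if $\sup_n\|\Delta_n\|_\infty<\infty$),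 then for every $A\in\mathcal F$, $\hat P_n(A)\to\nu(A)$ almost surely. -/

import Mathlib

open MeasureTheory Filter Topology
open scoped ENNReal

namespace EtaMixing

noncomputable section

/-- The total variation norm `[sup_A σ(A) - inf_A σ(A)] / 2` of a signed measure `σ`, written for
its underlying set function; `A` ranges over the measurable sets. -/
def tvNorm {S : Type*} [MeasurableSpace S] (σ : Set S → ℝ) : ℝ :=
  ((⨆ A : {A : Set S // MeasurableSet A}, σ A) -
    (⨅ A : {A : Set S // MeasurableSet A}, σ A)) / 2

open Classical in
/-- The Hamming metric on `Ω^n`, as a real number. -/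
def hamming {Ω : Type*} {n : ℕ} (x y : Fin n → Ω) : ℝ := (hammingDist x y : ℝ)

section Psi

variable {Ω : Type*} [MeasurableSpace Ω]

/-- The product measure `μ^n` on `Ω^n`. -/
abbrev prodMeasure (μ : Measure Ω) (n : ℕ) : Measure (Fin n → Ω) := Measure.pi fun _ => μ

/-- The projection `(π f)(x₂, …, xₙ) = ∫ f(x₁, x₂, …, xₙ) dμ(x₁)`. -/
def proj (μ : Measure Ω) {n : ℕ} (f : (Fin (n + 1) → Ω) → ℝ) (x : Fin n → Ω) : ℝ :=
  ∫ a, f (Fin.cons a x) ∂μ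

/-- The functional `Ψ_n`: `Ψ_0 = 0` and `Ψ_n(f) = Ψ_{n-1}(π f) + ∫ f₊ dμ^n`. -/
def Psi (μ : Measure Ω) : (n : ℕ) → ((Fin n → Ω) → ℝ) → ℝ
  | 0, _ => 0
  | n + 1, f => Psi μ n (proj μ f) + ∫ x, max (f x) 0 ∂(prodMeasure μ (n + 1))

/-- The set `Φ_n ⊆ L₁(μ^n)` of the measurable functions from `Ω^n` to `[0, diam_ρ(Ω^n)]` that are
1-Lipschitz for the metric `ρ`. -/
def PhiSet (μ : Measure Ω) (n : ℕ) (ρ : (Fin n → Ω) → (Fin n → Ω) → ℝ) :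
    Set ((Fin n → Ω) → ℝ) :=
  {g | Measurable g ∧ Integrable g (prodMeasure μ n) ∧
    (∀ x, 0 ≤ g x ∧ ENNReal.ofReal (g x) ≤ ⨆ (u : Fin n → Ω) (v : Fin n → Ω),
      ENNReal.ofReal (ρ u v)) ∧
    ∀ x y, |g x - g y| ≤ ρ x y}

/-- `(Ω^n, ρ)` is `Ψ`-dominated with respect to `μ`: `sup_{g ∈ Φ_n} ⟨f, g⟩ ≤ Ψ_n(f)` for every
`f ∈ L₁(μ^n)`. -/
def IsPsiDominated (μ : Measure Ω) (n : ℕ) (ρ : (Fin n → Ω) → (Fin n → Ω) → ℝ) : Prop :=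
  ∀ f : (Fin n → Ω) → ℝ, Integrable f (prodMeasure μ n) →
    ∀ g ∈ PhiSet μ n ρ, ∫ x, f x * g x ∂(prodMeasure μ n) ≤ Psi μ n f

end Psi

section Mixing

variable {Ω : Type*} [MeasurableSpace Ω] {n : ℕ}

/-- The point of `Ω^n` with the coordinates `x` up to and including `i` and `z` after `i`. -/
def glue (i : Fin n) (x : {k : Fin n // k ≤ i} → Ω) (z : {k : Fin n // i < k} → Ω) :
    Fin n → Ω :=
  fun k => if h : k ≤ i then x ⟨k, h⟩ else z ⟨k, not_le.mp h⟩

/-- The concatenation `y w`: the coordinates `y` before `i`, and `w` at `i`. -/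
def concat (i : Fin n) (y : {k : Fin n // k < i} → Ω) (w : Ω) : {k : Fin n // k ≤ i} → Ω :=
  fun k => if h : (k : Fin n) < i then y ⟨k, h⟩ else w

/-- For `Q` with density `p = dQ/dμ^n`, the unnormalised law of the coordinates after `i` when
the coordinates up to `i` are `x`: the measure with density `z ↦ p(x z)`. -/
def unnormalised (μ : Measure Ω) (Q : Measure (Fin n → Ω)) (i : Fin n)
    (x : {k : Fin n // k ≤ i} → Ω) : Measure ({k : Fin n // i < k} → Ω) :=
  (Measure.pi fun _ => μ).withDensity fun z => Q.rnDeriv (prodMeasure μ n) (glue i x z)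

/-- The density at `x` of the marginal of `Q` on the coordinates up to `i`. -/
def margDensity (μ : Measure Ω) (Q : Measure (Fin n → Ω)) (i : Fin n)
    (x : {k : Fin n // k ≤ i} → Ω) : ℝ≥0∞ :=
  unnormalised μ Q i x Set.univ

/-- The conditional law `ℒ(X_j, …, X_n | X_1, …, X_i = x)` for `X` with law `Q ≪ μ^n`. -/
def condLaw (μ : Measure Ω) (Q : Measure (Fin n → Ω)) {i j : Fin n} (hij : i < j)
    (x : {k : Fin n // k ≤ i} → Ω) : Measure ({k : Fin n // j ≤ k} → Ω) :=
  ((margDensity μ Q i x)⁻¹ • unnormalised μ Q i x).map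
    fun z k => z ⟨k, lt_of_lt_of_le hij k.2⟩

/-- `η_{ij}(y, w, w')`: the total variation distance between the laws of `(X_j, …, X_n)`
conditioned on the first `i` coordinates being `y w` and `y w'`. -/
def eta (μ : Measure Ω) (Q : Measure (Fin n → Ω)) {i j : Fin n} (hij : i < j)
    (y : {k : Fin n // k < i} → Ω) (w w' : Ω) : ℝ :=
  tvNorm fun B => (condLaw μ Q hij (concat i y w)).real B -
    (condLaw μ Q hij (concat i y w')).real B

/-- `η̄_{ij}`: the essential supremum, with respect to `μ`, of `η_{ij}(y, w, w')` over those
`y, w, w'` for which both conditional laws exist, that is, for which the density of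
`(X_1, …, X_i)` vanishes neither at `y w` nor at `y w'`. -/
def etaBar (μ : Measure Ω) (Q : Measure (Fin n → Ω)) {i j : Fin n} (hij : i < j) : ℝ :=
  essSup (fun q : ({k : Fin n // k < i} → Ω) × Ω × Ω => eta μ Q hij q.1 q.2.1 q.2.2)
    (((Measure.pi fun _ => μ).prod (μ.prod μ)).restrict
      {q | margDensity μ Q i (concat i q.1 q.2.1) ≠ 0 ∧
        margDensity μ Q i (concat i q.1 q.2.2) ≠ 0})

/-- The `η`-mixing matrix `Δ_n`: upper triangular, with ones on the diagonal and `η̄_{ij}` above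
it. -/
def mixingMatrix (μ : Measure Ω) (Q : Measure (Fin n → Ω)) : Matrix (Fin n) (Fin n) ℝ :=
  Matrix.of fun i j => if i = j then 1 else if hij : i < j then etaBar μ Q hij else 0

/-- The `ℓ_∞` operator norm `‖Δ_n‖_∞` (the maximal absolute row sum) of the mixing matrix. -/
def mixingNorm (μ : Measure Ω) (Q : Measure (Fin n → Ω)) : ℝ :=
  letI : NormedAddCommGroup (Matrix (Fin n) (Fin n) ℝ) := Matrix.linftyOpNormedAddCommGroup
  ‖mixingMatrix μ Q‖

end Mixing

section Empirical

variable {Ω : Type*} [MeasurableSpace Ω]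

/-- The first `n` terms `(X_1, …, X_n)` of a trajectory; `X_{k+1}` is the coordinate `ω k`. -/
def firstTerms (n : ℕ) (ω : ℕ → Ω) : Fin n → Ω := fun i => ω i

/-- The law `P_n` of `(X_1, …, X_n)` under `P`. -/
def marginal (P : Measure (ℕ → Ω)) (n : ℕ) : Measure (Fin n → Ω) := P.map (firstTerms n)

/-- The empirical measure `P̂_n(A) = (1/n) ∑ 1_{X_i ∈ A}` of the sample `x = (X_1, …, X_n)`. -/
def empirical {n : ℕ} (x : Fin n → Ω) (A : Set Ω) : ℝ :=
  (1 / (n : ℝ)) * ∑ i, A.indicator (fun _ => (1 : ℝ)) (x i)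

/-- `‖E P̂_n(·) - ν(·)‖_TV`. -/
def bias (P : Measure (ℕ → Ω)) (ν : Measure Ω) (n : ℕ) : ℝ :=
  tvNorm fun A : Set Ω => (∫ x, empirical x A ∂(marginal P n)) - ν.real A

end Empirical

end

end EtaMixing

/-! The proof is the martingale method. Write `Q` for the law of the sample and `p` for its density.
The conditional expectation `condCount` of the number of coordinates in `A`, given the first `k` of
them, is a quotient of two integrals of the tail coordinates. It interpolates between the mean (`k =
0`) and the count itself (`k = n`).

With the coordinates before `i` fixed, changing coordinate `i` changes its own indicator by at most
1 and the conditional probability of each later event `X_j ∈ A` by at most `η̄_{ij}`. So the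
oscillation is at most a row sum of the mixing matrix (`abs_condCount_sub_le`). Hoeffding's lemma
turns this into a factor `exp(‖Δ‖² l² / 2)` per step (`lintegral_exp_condCount_succ_le`). After `n`
steps the centred count is sub-Gaussian with parameter `n ‖Δ‖²`, and Chernoff's bound follows
(`measureReal_abs_empirical_sub_ge_le`).

The bias is absorbed into `ε`. Vanishing bias forces `ν` to have mass 1, and then the halved total
variation norm bounds the bias on every single set. Almost sure convergence is Borel–Cantelli. -/

namespace EtaMixing

/-! ### Total variation of set functions -/

section TotalVariation

variable {S : Type*} [MeasurableSpace S]

/-- The bound `c` only guarantees that the real supremum and infimum are genuine. -/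
theorem le_two_mul_tvNorm {σ : Set S → ℝ} {c : ℝ} (hc : ∀ B, |σ B| ≤ c) {B C : Set S}
    (hB : MeasurableSet B) (hC : MeasurableSet C) : σ B - σ C ≤ 2 * tvNorm σ := by
  have h1 : σ B ≤ ⨆ A : {A : Set S // MeasurableSet A}, σ A :=
    le_ciSup (f := fun A : {A : Set S // MeasurableSet A} => σ A)
      ⟨c, by rintro _ ⟨A, rfl⟩; exact (abs_le.1 (hc A)).2⟩ ⟨B, hB⟩
  have h2 : (⨅ A : {A : Set S // MeasurableSet A}, σ A) ≤ σ C :=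
    ciInf_le (f := fun A : {A : Set S // MeasurableSet A} => σ A)
      ⟨-c, by rintro _ ⟨A, rfl⟩; exact (abs_le.1 (hc A)).1⟩ ⟨C, hC⟩
  unfold tvNorm
  linarith

/-- Antisymmetry under complement gives `σ B - σ Bᶜ = 2 σ B`, which cancels the factor one half in
the norm. For signed measures this is the case of total mass zero. -/
theorem abs_le_tvNorm {σ : Set S → ℝ} {c : ℝ} (hc : ∀ B, |σ B| ≤ c)
    (hσ : ∀ B, MeasurableSet B → σ Bᶜ = -σ B) {B : Set S} (hB : MeasurableSet B) :
    |σ B| ≤ tvNorm σ := by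
  have h1 := le_two_mul_tvNorm hc hB hB.compl
  have h2 := le_two_mul_tvNorm hc hB.compl hB
  rw [hσ B hB] at h1 h2
  rw [abs_le]
  constructor <;> linarith

theorem tvNorm_le {σ : Set S → ℝ} {c : ℝ} (hc : ∀ B, |σ B| ≤ c) : tvNorm σ ≤ c := by
  have : Nonempty {A : Set S // MeasurableSet A} := ⟨⟨∅, .empty⟩⟩
  have h1 : (⨆ A : {A : Set S // MeasurableSet A}, σ A) ≤ c :=
    ciSup_le fun A => (abs_le.1 (hc A)).2
  have h2 : -c ≤ ⨅ A : {A : Set S // MeasurableSet A}, σ A :=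
    le_ciInf fun A => (abs_le.1 (hc A)).1
  unfold tvNorm
  linarith

theorem abs_measureReal_sub_le_one (α β : Measure S) (hα : α Set.univ ≤ 1) (hβ : β Set.univ ≤ 1)
    (B : Set S) : |α.real B - β.real B| ≤ 1 := by
  have key : ∀ γ : Measure S, γ Set.univ ≤ 1 → γ.real B ≤ 1 := fun γ hγ =>
    ENNReal.toReal_le_of_le_ofReal zero_le_one (by simpa using (measure_mono B.subset_univ).trans hγ)
  have h1 := key α hα
  have h2 := key β hβ
  have h3 : 0 ≤ α.real B := measureReal_nonneg
  have h4 : 0 ≤ β.real B := measureReal_nonneg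
  rw [abs_le]
  constructor <;> linarith

theorem abs_measureReal_sub_le_tvNorm (α β : Measure S) [IsProbabilityMeasure α]
    [IsProbabilityMeasure β] {B : Set S} (hB : MeasurableSet B) :
    |α.real B - β.real B| ≤ tvNorm fun B => α.real B - β.real B :=
  abs_le_tvNorm (σ := fun B => α.real B - β.real B)
    (abs_measureReal_sub_le_one α β prob_le_one prob_le_one)
    (fun B hB => by simp only [probReal_compl_eq_one_sub hB]; ring) hB

end TotalVariation

/-! ### Hoeffding's lemma for an unnormalised density -/

section Averaging

open ProbabilityTheory

/-- Hoeffding's lemma for the probability density `a / ∫ a` and a function `H / a` whose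
oscillation is at most `R`. -/
theorem lintegral_exp_ratio_mul_le {W : Type*} [MeasurableSpace W] (μ : Measure W) [SFinite μ]
    {a H : W → ℝ≥0∞} (ha : Measurable a) (hH : Measurable H) (hfin : ∫⁻ w, a w ∂μ ≠ ∞)
    {c : ℝ≥0∞} (hc : c ≠ ∞) (hHa : ∀ w, H w ≤ c * a w) {R : ℝ} (hR : 0 ≤ R)
    (hosc : ∀ᵐ w ∂μ, ∀ᵐ w' ∂μ, a w ≠ 0 → a w' ≠ 0 →
      |(H w / a w).toReal - (H w' / a w').toReal| ≤ R) (l : ℝ) :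
    ∫⁻ w, ENNReal.ofReal (Real.exp (l * (H w / a w).toReal)) * a w ∂μ ≤
      ENNReal.ofReal (Real.exp (R ^ 2 * l ^ 2 / 2)) *
        (ENNReal.ofReal (Real.exp (l * ((∫⁻ w, H w ∂μ) / ∫⁻ w, a w ∂μ).toReal)) *
          ∫⁻ w, a w ∂μ) := by
  set a0 := ∫⁻ w, a w ∂μ with ha0
  rcases eq_or_ne a0 0 with h0 | h0
  · have : a =ᵐ[μ] 0 := (lintegral_eq_zero_iff ha).1 h0
    have hz : ∫⁻ w, ENNReal.ofReal (Real.exp (l * (H w / a w).toReal)) * a w ∂μ = 0 := by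
      rw [← lintegral_zero (μ := μ)]
      refine lintegral_congr_ae ?_
      filter_upwards [this] with w hw
      simp [hw]
    exact hz.trans_le bot_le
  set M : W → ℝ := fun w => (H w / a w).toReal with hM
  have hMm : Measurable M := (hH.div ha).ennreal_toReal
  set d : W → ℝ≥0∞ := fun w => a w / a0 with hd
  have hdm : Measurable d := ha.div_const _
  set κ := μ.withDensity d with hκ
  have hdint : ∫⁻ w, d w ∂μ = 1 := by
    simp only [hd, div_eq_mul_inv]
    rw [lintegral_mul_const _ ha, ← ha0, ENNReal.mul_inv_cancel h0 hfin]
  have : IsProbabilityMeasure κ := ⟨by rw [hκ, withDensity_apply _ .univ]; simpa using hdint⟩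
  have hafin : ∀ᵐ w ∂μ, a w < ∞ := ae_lt_top ha hfin
  have hκae : ∀ {p : W → Prop}, (∀ᵐ w ∂μ, a w ≠ 0 → p w) → ∀ᵐ w ∂κ, p w := by
    intro p hp
    rw [hκ, ae_withDensity_iff hdm]
    filter_upwards [hp] with w hw hdw
    refine hw fun h => hdw ?_
    simp [hd, h]
  -- the mean of `M` under `κ`
  have hmean : ∫ w, M w ∂κ = ((∫⁻ w, H w ∂μ) / a0).toReal := by
    have hlt : ∀ w, a w ≠ 0 → H w / a w < ∞ := fun w hw =>
      lt_of_le_of_lt (ENNReal.div_le_of_le_mul (hHa w)) hc.lt_top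
    have hint : ∫ w, M w ∂κ = (∫⁻ w, (H / a) w ∂κ).toReal :=
      integral_toReal (hH.div ha).aemeasurable (hκae (Eventually.of_forall hlt))
    rw [hint, hκ, lintegral_withDensity_eq_lintegral_mul _ hdm (hH.div ha), div_eq_mul_inv (∫⁻ w, H w ∂μ),
      ← lintegral_mul_const _ hH]
    congr 1
    refine lintegral_congr_ae ?_
    filter_upwards [hafin] with w hw
    simp only [Pi.mul_apply, hd, div_eq_mul_inv]
    -- Where `a` vanishes, so does `H` by domination; the convention for division by zero is then
    -- harmless.
    rcases eq_or_ne (a w) 0 with h | h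
    · have : H w = 0 := by simpa [h] using hHa w
      simp [h, this]
    · calc a w * a0⁻¹ * (H w * (a w)⁻¹) = H w * a0⁻¹ * (a w * (a w)⁻¹) := by ring
        _ = _ := by rw [ENNReal.mul_inv_cancel h hw.ne, mul_one]
  -- an interval of length `2 R` that contains `M` almost surely
  have hosc' : ∀ᵐ w ∂κ, ∀ᵐ w' ∂κ, |M w - M w'| ≤ R := by
    refine hκae ?_
    filter_upwards [hosc] with w hw haw
    refine hκae ?_
    filter_upwards [hw] with w' hw' haw'
    exact hw' haw haw'
  obtain ⟨w₀, hw₀⟩ := hosc'.exists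
  have hIcc : ∀ᵐ w ∂κ, M w ∈ Set.Icc (M w₀ - R) (M w₀ + R) := by
    filter_upwards [hw₀] with w hw
    rw [abs_le] at hw
    constructor <;> linarith
  have hsub := (hasSubgaussianMGF_of_mem_Icc hMm.aemeasurable hIcc).mgf_le l
  have hint := (hasSubgaussianMGF_of_mem_Icc hMm.aemeasurable hIcc).integrable_exp_mul l
  set m := ∫ w, M w ∂κ with hm
  -- Hoeffding's parameter is the squared half-length. Centring the interval at one typical value
  -- costs a factor 2 in length, and the resulting `R ^ 2` is exactly what the theorem's constant
  -- needs.
  have hcst : (((‖M w₀ + R - (M w₀ - R)‖₊ / 2) ^ 2 : NNReal) : ℝ) = R ^ 2 := by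
    have : M w₀ + R - (M w₀ - R) = 2 * R := by ring
    rw [this]
    simp [abs_of_nonneg hR]
  rw [hcst, mgf] at hsub
  have hE : ∫⁻ w, ENNReal.ofReal (Real.exp (l * (M w - m))) ∂κ ≤
      ENNReal.ofReal (Real.exp (R ^ 2 * l ^ 2 / 2)) := by
    rw [← ofReal_integral_eq_lintegral_ofReal hint (Eventually.of_forall fun w => (Real.exp_pos _).le)]
    exact ENNReal.ofReal_le_ofReal hsub
  have hmeas : Measurable fun w => ENNReal.ofReal (Real.exp (l * (M w - m))) := by fun_prop
  rw [hκ, lintegral_withDensity_eq_lintegral_mul _ hdm hmeas] at hE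
  rw [← hmean]
  calc ∫⁻ w, ENNReal.ofReal (Real.exp (l * M w)) * a w ∂μ
      = ∫⁻ w, (d * fun w => ENNReal.ofReal (Real.exp (l * (M w - m)))) w *
          (ENNReal.ofReal (Real.exp (l * m)) * a0) ∂μ := by
        refine lintegral_congr fun w => ?_
        have e1 : ENNReal.ofReal (Real.exp (l * M w)) =
            ENNReal.ofReal (Real.exp (l * (M w - m))) * ENNReal.ofReal (Real.exp (l * m)) := by
          rw [← ENNReal.ofReal_mul (Real.exp_pos _).le, ← Real.exp_add]
          congr 2; ring
        have e2 : a w = d w * a0 := (ENNReal.div_mul_cancel h0 hfin).symm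
        rw [e1, Pi.mul_apply]
        nth_rw 1 [e2]
        ring
    _ = (∫⁻ w, (d * fun w => ENNReal.ofReal (Real.exp (l * (M w - m)))) w ∂μ) *
          (ENNReal.ofReal (Real.exp (l * m)) * a0) :=
        lintegral_mul_const _ (hdm.mul hmeas)
    _ ≤ _ := by gcongr

end Averaging

/-! ### Splitting a point at a coordinate, and integrating out tails -/

section ExtendHead

variable {Ω : Type*} {n : ℕ}

/-- The point of `Ω^n` with the coordinates `y` before `i` and those of `x₀` from `i` on. -/
def extendHead (x₀ : Fin n → Ω) (i : Fin n) (y : {k : Fin n // k < i} → Ω) : Fin n → Ω :=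
  fun k => if h : k < i then y ⟨k, h⟩ else x₀ k

theorem restrict_update_extendHead (x₀ : Fin n → Ω) (i : Fin n) (y : {k : Fin n // k < i} → Ω)
    (w : Ω) : (fun k : {k : Fin n // k ≤ i} => Function.update (extendHead x₀ i y) i w k) =
      concat i y w := by
  funext ⟨k, hk⟩
  rcases lt_or_eq_of_le hk with h | h
  · simp [concat, extendHead, h, h.ne]
  · subst h; simp [concat]

end ExtendHead

section Marginals

variable {Ω : Type*} [MeasurableSpace Ω] {n : ℕ} (μ : Measure Ω)

/-- Reindexes from subtypes of a finset to the subtypes of a predicate on which the conditional laws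
are defined. -/
theorem lmarginal_filter_apply [SigmaFinite μ] (q : Fin n → Prop) [DecidablePred q]
    (f : (Fin n → Ω) → ℝ≥0∞) (x : Fin n → Ω) :
    lmarginal (fun _ : Fin n => μ) (Finset.univ.filter q) f x =
      ∫⁻ z : {k // q k} → Ω, f (fun k => if h : q k then z ⟨k, h⟩ else x k)
        ∂Measure.pi fun _ => μ := by
  let e : {k // q k} ≃ {k // k ∈ Finset.univ.filter q} :=
    Equiv.subtypeEquivRight (by simp)
  have h := (measurePreserving_piCongrLeft (fun _ : {k // k ∈ Finset.univ.filter q} => μ) e)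
  rw [lmarginal, ← h.lintegral_comp_emb (MeasurableEquiv.measurableEmbedding _)]
  refine lintegral_congr fun z => ?_
  congr 1
  funext k
  by_cases hk : q k
  · have hk' : k ∈ Finset.univ.filter q := by simpa using hk
    simp only [Function.updateFinset, hk, hk', dif_pos]
    exact Equiv.piCongrLeft_apply_apply (fun _ => Ω) e z ⟨k, hk⟩
  · have hk' : k ∉ Finset.univ.filter q := by simpa using hk
    simp only [Function.updateFinset, hk, hk', dif_neg, not_false_iff]

/-- The integral of `f` over the coordinates from the `k`-th on. -/
noncomputable def tailIntegral (k : ℕ) (f : (Fin n → Ω) → ℝ≥0∞) : (Fin n → Ω) → ℝ≥0∞ :=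
  lmarginal (fun _ : Fin n => μ) (Finset.univ.filter fun j : Fin n => k ≤ (j : ℕ)) f

variable {μ}

theorem tailIntegral_congr {k : ℕ} (f : (Fin n → Ω) → ℝ≥0∞) {x y : Fin n → Ω}
    (h : ∀ j : Fin n, (j : ℕ) < k → x j = y j) : tailIntegral μ k f x = tailIntegral μ k f y :=
  lmarginal_congr _ _ fun j hj => h j (by simpa using hj)

theorem tailIntegral_mono {k : ℕ} {f g : (Fin n → Ω) → ℝ≥0∞} (h : ∀ x, f x ≤ g x)
    (x : Fin n → Ω) : tailIntegral μ k f x ≤ tailIntegral μ k g x :=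
  lintegral_mono fun _ => h _

theorem tailIntegral_length (f : (Fin n → Ω) → ℝ≥0∞) : tailIntegral μ n f = f := by
  have : (Finset.univ.filter fun j : Fin n => n ≤ (j : ℕ)) = ∅ := by
    ext j; simp
  rw [tailIntegral, this, lmarginal_empty]

/-- "Taking out what is known": `g` depends only on the first `k` coordinates. -/
theorem tailIntegral_mul_of_invariant {k : ℕ} {g f : (Fin n → Ω) → ℝ≥0∞} (hf : Measurable f)
    (hg : ∀ x y : Fin n → Ω, (∀ j : Fin n, (j : ℕ) < k → x j = y j) → g x = g y)
    (x : Fin n → Ω) :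
    tailIntegral μ k (fun x => g x * f x) x = g x * tailIntegral μ k f x := by
  simp only [tailIntegral, lmarginal]
  have hfm : Measurable fun y : {j // j ∈ Finset.univ.filter fun j : Fin n => k ≤ (j : ℕ)} → Ω =>
      f (Function.updateFinset x _ y) := hf.comp measurable_updateFinset
  rw [← lintegral_const_mul _ hfm]
  refine lintegral_congr fun z => ?_
  congr 1
  refine hg _ _ fun j hj => ?_
  have : j ∉ Finset.univ.filter fun j : Fin n => k ≤ (j : ℕ) := by simpa using hj
  simp [Function.updateFinset, hj]

variable [SigmaFinite μ]

theorem measurable_tailIntegral {k : ℕ} {f : (Fin n → Ω) → ℝ≥0∞} (hf : Measurable f) :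
    Measurable (tailIntegral μ k f) := hf.lmarginal _

theorem tailIntegral_zero (f : (Fin n → Ω) → ℝ≥0∞) (x : Fin n → Ω) :
    tailIntegral μ 0 f x = ∫⁻ x, f x ∂prodMeasure μ n := by
  have : (Finset.univ.filter fun j : Fin n => 0 ≤ (j : ℕ)) = Finset.univ := by
    ext j; simp
  rw [tailIntegral, this, ← lintegral_eq_lmarginal_univ]

/-- The tower property, by Fubini. Applied to numerator and denominator of `condCount`, it replaces
the martingale identity. -/
theorem tailIntegral_eq_lintegral_update {f : (Fin n → Ω) → ℝ≥0∞} (hf : Measurable f) (i : Fin n)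
    (x : Fin n → Ω) :
    tailIntegral μ i f x = ∫⁻ w, tailIntegral μ (i + 1) f (Function.update x i w) ∂μ := by
  have : (Finset.univ.filter fun j : Fin n => (i : ℕ) ≤ (j : ℕ)) =
      insert i (Finset.univ.filter fun j : Fin n => (i : ℕ) + 1 ≤ (j : ℕ)) := by
    ext j
    simp only [Finset.mem_filter, Finset.mem_univ, true_and, Finset.mem_insert, Fin.ext_iff]
    omega
  rw [tailIntegral, this, lmarginal_insert _ hf (by simp)]
  rfl

theorem tailIntegral_succ_eq_glue (f : (Fin n → Ω) → ℝ≥0∞) (i : Fin n) (x : Fin n → Ω) :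
    tailIntegral μ (i + 1) f x =
      ∫⁻ z : {k : Fin n // i < k} → Ω, f (glue i (fun k => x k) z) ∂Measure.pi fun _ => μ := by
  have : (Finset.univ.filter fun j : Fin n => (i : ℕ) + 1 ≤ (j : ℕ)) =
      Finset.univ.filter fun j : Fin n => i < j := by
    ext j; simp
  rw [tailIntegral, this, lmarginal_filter_apply]
  refine lintegral_congr fun z => ?_
  congr 1
  funext k
  by_cases h : i < k
  · simp [glue, h]
  · simp [glue, h, not_lt.1 h]

theorem measurable_extendHead (x₀ : Fin n → Ω) (i : Fin n) : Measurable (extendHead x₀ i) := by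
  refine measurable_pi_lambda _ fun k => ?_
  by_cases h : k < i
  · simpa [extendHead, h] using measurable_pi_apply _
  · simp [extendHead, h]

/-- Fubini again; the choice of `x₀` is immaterial, as the tail integral overwrites those
coordinates. -/
theorem lintegral_eq_lintegral_extendHead {f : (Fin n → Ω) → ℝ≥0∞} (hf : Measurable f)
    (x₀ : Fin n → Ω) (i : Fin n) :
    ∫⁻ x, f x ∂prodMeasure μ n =
      ∫⁻ y, tailIntegral μ i f (extendHead x₀ i y) ∂Measure.pi fun _ => μ := by
  have hu : (Finset.univ : Finset (Fin n)) = (Finset.univ.filter fun j : Fin n => j < i) ∪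
      Finset.univ.filter fun j : Fin n => (i : ℕ) ≤ (j : ℕ) := by
    ext j
    simp only [Finset.mem_univ, Finset.mem_union, Finset.mem_filter, true_and, true_iff, Fin.lt_def]
    omega
  have hd : Disjoint (Finset.univ.filter fun j : Fin n => j < i)
      (Finset.univ.filter fun j : Fin n => (i : ℕ) ≤ (j : ℕ)) := by
    rw [Finset.disjoint_filter]
    intro j _ h
    simpa using h
  rw [lintegral_eq_lmarginal_univ x₀, hu, lmarginal_union _ _ hf hd, lmarginal_filter_apply]
  rfl

end Marginals

end EtaMixing

namespace EtaMixing

/-! ### Counting visits to a set -/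

section Count

variable {Ω : Type*} {n : ℕ}

/-- The number of coordinates of `x` in `A`. -/
noncomputable def count (A : Set Ω) (x : Fin n → Ω) : ℝ≥0∞ :=
  ∑ j, A.indicator (fun _ => (1 : ℝ≥0∞)) (x j)

theorem count_le (A : Set Ω) (x : Fin n → Ω) : count A x ≤ n := by
  calc count A x ≤ ∑ _j : Fin n, (1 : ℝ≥0∞) :=
        Finset.sum_le_sum fun j _ => Set.indicator_le_self' (fun _ _ => zero_le_one) _
    _ = n := by simp

theorem empirical_eq_count (x : Fin n → Ω) (A : Set Ω) :
    empirical x A = (1 / (n : ℝ)) * (count A x).toReal := by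
  rw [empirical, count, ENNReal.toReal_sum]
  · congr 1
    refine Finset.sum_congr rfl fun j _ => ?_
    by_cases h : x j ∈ A <;> simp [h]
  · intro j _
    by_cases h : x j ∈ A <;> simp [h]

end Count

/-! ### Conditional expectations of the count and the mixing matrix -/

section Conditional

variable {Ω : Type*} [MeasurableSpace Ω] {n : ℕ}

theorem measurable_count {A : Set Ω} (hA : MeasurableSet A) :
    Measurable (count A : (Fin n → Ω) → ℝ≥0∞) :=
  Finset.measurable_sum _ fun j _ =>
    (measurable_const.indicator hA).comp (measurable_pi_apply j)

variable (μ : Measure Ω) (Q : Measure (Fin n → Ω))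

/-- The conditional expectation of the number of coordinates in `A`, given the first `k`
coordinates. -/
noncomputable def condCount (A : Set Ω) (k : ℕ) (x : Fin n → Ω) : ℝ :=
  (tailIntegral μ k (fun x => count A x * Q.rnDeriv (prodMeasure μ n) x) x /
    tailIntegral μ k (Q.rnDeriv (prodMeasure μ n)) x).toReal

theorem condCount_congr (A : Set Ω) {k : ℕ} {x y : Fin n → Ω}
    (h : ∀ j : Fin n, (j : ℕ) < k → x j = y j) : condCount μ Q A k x = condCount μ Q A k y := by
  rw [condCount, condCount, tailIntegral_congr _ h, tailIntegral_congr _ h]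

theorem measurable_glue (i : Fin n) (x : {k : Fin n // k ≤ i} → Ω) : Measurable (glue i x) := by
  refine measurable_pi_lambda _ fun k => ?_
  by_cases h : k ≤ i
  · simp [glue, h]
  · simpa [glue, h] using measurable_pi_apply _

theorem condLaw_univ_le {i j : Fin n} (hij : i < j) (x : {k : Fin n // k ≤ i} → Ω) :
    condLaw μ Q hij x Set.univ ≤ 1 := by
  rw [condLaw, Measure.map_apply (by fun_prop) .univ, Set.preimage_univ, Measure.smul_apply,
    smul_eq_mul]
  exact ENNReal.inv_mul_le_one _

theorem isProbabilityMeasure_condLaw {i j : Fin n} (hij : i < j) (x : {k : Fin n // k ≤ i} → Ω)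
    (h0 : margDensity μ Q i x ≠ 0) (h1 : margDensity μ Q i x ≠ ∞) :
    IsProbabilityMeasure (condLaw μ Q hij x) := by
  constructor
  rw [condLaw, Measure.map_apply (by fun_prop) .univ, Set.preimage_univ, Measure.smul_apply,
    smul_eq_mul]
  exact ENNReal.inv_mul_cancel h0 h1

theorem condLaw_coord {A : Set Ω} (hA : MeasurableSet A) {i j : Fin n} (hij : i < j)
    (x : {k : Fin n // k ≤ i} → Ω) :
    condLaw μ Q hij x {z | z ⟨j, le_rfl⟩ ∈ A} =
      (∫⁻ z : {k : Fin n // i < k} → Ω, A.indicator (fun _ => (1 : ℝ≥0∞)) (glue i x z j) *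
        Q.rnDeriv (prodMeasure μ n) (glue i x z) ∂Measure.pi fun _ => μ) *
      (margDensity μ Q i x)⁻¹ := by
  have hB : MeasurableSet {z : {k : Fin n // j ≤ k} → Ω | z ⟨j, le_rfl⟩ ∈ A} :=
    measurable_pi_apply _ hA
  have hB' : MeasurableSet {z : {k : Fin n // i < k} → Ω | z ⟨j, hij⟩ ∈ A} :=
    measurable_pi_apply _ hA
  rw [condLaw, Measure.map_apply (by fun_prop) hB, Measure.smul_apply, smul_eq_mul, mul_comm]
  congr 1
  change unnormalised μ Q i x {z : {k : Fin n // i < k} → Ω | z ⟨j, hij⟩ ∈ A} = _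
  rw [unnormalised, withDensity_apply _ hB', ← lintegral_indicator hB']
  refine lintegral_congr fun z => ?_
  by_cases h : z ⟨j, hij⟩ ∈ A <;> simp [glue, not_le.2 hij, h]

/-- The bound `eta ≤ 1` is needed for the real essential supremum to dominate almost everywhere. -/
theorem ae_eta_le_etaBar {i j : Fin n} (hij : i < j) :
    ∀ᵐ q : ({k : Fin n // k < i} → Ω) × Ω × Ω ∂(Measure.pi fun _ => μ).prod (μ.prod μ),
      margDensity μ Q i (concat i q.1 q.2.1) ≠ 0 → margDensity μ Q i (concat i q.1 q.2.2) ≠ 0 →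
        eta μ Q hij q.1 q.2.1 q.2.2 ≤ etaBar μ Q hij := by
  have hb : ∀ᶠ c in Filter.map (fun q : ({k : Fin n // k < i} → Ω) × Ω × Ω =>
      eta μ Q hij q.1 q.2.1 q.2.2) (ae (((Measure.pi fun _ => μ).prod
      (μ.prod μ)).restrict {q | margDensity μ Q i (concat i q.1 q.2.1) ≠ 0 ∧
        margDensity μ Q i (concat i q.1 q.2.2) ≠ 0})), c ≤ 1 :=
    Filter.eventually_map.2 (Eventually.of_forall fun q => tvNorm_le
      (abs_measureReal_sub_le_one _ _ (condLaw_univ_le μ Q hij _) (condLaw_univ_le μ Q hij _)))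
  have h := ae_imp_of_ae_restrict (ae_le_essSup (μ := ((Measure.pi fun _ => μ).prod
      (μ.prod μ)).restrict {q | margDensity μ Q i (concat i q.1 q.2.1) ≠ 0 ∧
        margDensity μ Q i (concat i q.1 q.2.2) ≠ 0})
    (f := fun q : ({k : Fin n // k < i} → Ω) × Ω × Ω => eta μ Q hij q.1 q.2.1 q.2.2)
    ⟨1, hb⟩)
  filter_upwards [h] with q hq h1 h2
  exact hq ⟨h1, h2⟩

theorem sum_abs_mixingMatrix_le_mixingNorm (i : Fin n) :
    ∑ j, |mixingMatrix μ Q i j| ≤ mixingNorm μ Q := by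
  have h : (∑ j, ‖mixingMatrix μ Q i j‖₊ : NNReal) ≤
      Finset.univ.sup fun i => ∑ j, ‖mixingMatrix μ Q i j‖₊ :=
    Finset.le_sup (f := fun i => ∑ j, ‖mixingMatrix μ Q i j‖₊) (Finset.mem_univ i)
  have h2 : mixingNorm μ Q =
      ((Finset.univ.sup fun i => ∑ j, ‖mixingMatrix μ Q i j‖₊ : NNReal) : ℝ) :=
    Matrix.linfty_opNorm_def _
  rw [h2]
  refine le_trans (le_of_eq ?_) (NNReal.coe_le_coe.2 h)
  simp

theorem one_le_mixingNorm (i : Fin n) : 1 ≤ mixingNorm μ Q := by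
  refine le_trans ?_ (sum_abs_mixingMatrix_le_mixingNorm μ Q i)
  have := Finset.single_le_sum (f := fun j => |mixingMatrix μ Q i j|)
    (fun j _ => abs_nonneg _) (Finset.mem_univ i)
  simpa [mixingMatrix] using this

variable [SigmaFinite μ]

theorem tailIntegral_rnDeriv_eq_margDensity (i : Fin n) (x : Fin n → Ω) :
    tailIntegral μ (i + 1) (Q.rnDeriv (prodMeasure μ n)) x =
      margDensity μ Q i (fun k => x k) := by
  rw [tailIntegral_succ_eq_glue, margDensity, unnormalised, withDensity_apply _ .univ,
    Measure.restrict_univ]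

/-- Linearity of conditional expectation: coordinates up to `i` are known, later ones contribute
conditional probabilities. -/
theorem condCount_succ {A : Set Ω} (hA : MeasurableSet A) (i : Fin n) (x : Fin n → Ω)
    (h0 : margDensity μ Q i (fun k => x k) ≠ 0) (h1 : margDensity μ Q i (fun k => x k) ≠ ∞) :
    condCount μ Q A (i + 1) x = ∑ j, if hij : i < j then
      (condLaw μ Q hij fun k => x k).real {z | z ⟨j, le_rfl⟩ ∈ A}
      else A.indicator (fun _ => (1 : ℝ)) (x j) := by
  have hp : Measurable (Q.rnDeriv (prodMeasure μ n)) := Measure.measurable_rnDeriv _ _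
  have hpg : Measurable fun z => Q.rnDeriv (prodMeasure μ n) (glue i (fun k => x k) z) :=
    hp.comp (measurable_glue i _)
  have hcoord : ∀ j, Measurable fun z : {k : Fin n // i < k} → Ω => glue i (fun k => x k) z j :=
    fun j => measurable_pi_iff.1 (measurable_glue i fun k => x k) j
  have hind : Measurable (A.indicator fun _ => (1 : ℝ≥0∞)) := measurable_const.indicator hA
  have hterm : ∀ j, Measurable fun z : {k : Fin n // i < k} → Ω =>
      A.indicator (fun _ => (1 : ℝ≥0∞)) (glue i (fun k => x k) z j) *
        Q.rnDeriv (prodMeasure μ n) (glue i (fun k => x k) z) := fun j =>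
    (hind.comp (hcoord j)).mul hpg
  have hsum : tailIntegral μ (i + 1) (fun x => count A x * Q.rnDeriv (prodMeasure μ n) x) x /
      tailIntegral μ (i + 1) (Q.rnDeriv (prodMeasure μ n)) x =
      ∑ j, if hij : i < j then (condLaw μ Q hij fun k => x k) {z | z ⟨j, le_rfl⟩ ∈ A}
        else A.indicator (fun _ => (1 : ℝ≥0∞)) (x j) := by
    rw [tailIntegral_rnDeriv_eq_margDensity, tailIntegral_succ_eq_glue]
    simp only [count, Finset.sum_mul]
    rw [lintegral_finsetSum _ fun j _ => hterm j, div_eq_mul_inv, Finset.sum_mul]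
    refine Finset.sum_congr rfl fun j _ => ?_
    by_cases hij : i < j
    · rw [dif_pos hij, condLaw_coord μ Q hA]
    · rw [dif_neg hij]
      have hg : ∀ z, glue i (fun k => x k) z j = x j := fun z => by simp [glue, not_lt.1 hij]
      simp only [hg]
      rw [lintegral_const_mul _ hpg, mul_assoc,
        ← tailIntegral_succ_eq_glue, tailIntegral_rnDeriv_eq_margDensity,
        ENNReal.mul_inv_cancel h0 h1, mul_one]
  rw [condCount, hsum, ENNReal.toReal_sum]
  · refine Finset.sum_congr rfl fun j _ => ?_
    by_cases hij : i < j
    · simp only [dif_pos hij]; rfl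
    · simp only [dif_neg hij]
      by_cases h : x j ∈ A <;> simp [h]
  · intro j _
    by_cases hij : i < j
    · simp only [dif_pos hij]
      exact ((measure_mono (Set.subset_univ _)).trans (condLaw_univ_le μ Q hij _)).trans_lt
        ENNReal.one_lt_top |>.ne
    · simp only [dif_neg hij]
      by_cases h : x j ∈ A <;> simp [h]

/-- Changing the last of the first `i` coordinates changes the conditional expectation of the
count by at most the `i`-th row sum of the mixing matrix. -/
theorem abs_condCount_sub_le {A : Set Ω} (hA : MeasurableSet A) (i : Fin n)
    {x : Fin n → Ω} {y : {k : Fin n // k < i} → Ω} {w w' : Ω}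
    (hw : (fun k : {k : Fin n // k ≤ i} => Function.update x i w k) = concat i y w)
    (hw' : (fun k : {k : Fin n // k ≤ i} => Function.update x i w' k) = concat i y w')
    (h0 : margDensity μ Q i (concat i y w) ≠ 0) (h1 : margDensity μ Q i (concat i y w) ≠ ∞)
    (h0' : margDensity μ Q i (concat i y w') ≠ 0) (h1' : margDensity μ Q i (concat i y w') ≠ ∞)
    (heta : ∀ j (hij : i < j), eta μ Q hij y w w' ≤ etaBar μ Q hij) :
    |condCount μ Q A (i + 1) (Function.update x i w) -
      condCount μ Q A (i + 1) (Function.update x i w')| ≤ mixingNorm μ Q := by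
  rw [condCount_succ μ Q hA i _ (hw ▸ h0) (hw ▸ h1), condCount_succ μ Q hA i _ (hw' ▸ h0') (hw' ▸ h1'),
    ← Finset.sum_sub_distrib]
  refine le_trans (Finset.abs_sum_le_sum_abs _ _) (le_trans (Finset.sum_le_sum fun j _ => ?_)
    (sum_abs_mixingMatrix_le_mixingNorm μ Q i))
  rw [hw, hw']
  by_cases hij : i < j
  · simp only [dif_pos hij, mixingMatrix, Matrix.of_apply, if_neg hij.ne]
    have := isProbabilityMeasure_condLaw μ Q hij _ h0 h1
    have := isProbabilityMeasure_condLaw μ Q hij _ h0' h1'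
    exact ((abs_measureReal_sub_le_tvNorm _ _ (measurable_pi_apply _ hA)).trans
      (heta j hij)).trans (le_abs_self _)
  · simp only [dif_neg hij]
    rcases eq_or_ne i j with rfl | hne
    · simp only [mixingMatrix, Matrix.of_apply, if_true, Function.update_self, abs_one]
      by_cases h : w ∈ A <;> by_cases h' : w' ∈ A <;> simp [h, h']
    · simp [Function.update_of_ne hne.symm]

variable [IsProbabilityMeasure Q]

/-- One martingale step: for almost every past `y`, Hoeffding's lemma is applied in the variable `w`
at place `i`, with the density of `y w` as weight. -/
theorem lintegral_exp_condCount_succ_le {A : Set Ω} (hA : MeasurableSet A)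
    (hQ : Q ≪ prodMeasure μ n) (i : Fin n) (l : ℝ) :
    ∫⁻ x, ENNReal.ofReal (Real.exp (l * condCount μ Q A (i + 1) x)) ∂Q ≤
      ENNReal.ofReal (Real.exp (mixingNorm μ Q ^ 2 * l ^ 2 / 2)) *
        ∫⁻ x, ENNReal.ofReal (Real.exp (l * condCount μ Q A i x)) ∂Q := by
  set p := Q.rnDeriv (prodMeasure μ n) with hpdef
  have hp : Measurable p := Measure.measurable_rnDeriv _ _
  have hcp : Measurable fun x => count A x * p x := (measurable_count hA).mul hp
  have hQp : (prodMeasure μ n).withDensity p = Q := Measure.withDensity_rnDeriv_eq _ _ hQ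
  have hM : ∀ k, Measurable fun x => ENNReal.ofReal (Real.exp (l * condCount μ Q A k x)) := by
    intro k
    have : Measurable (condCount μ Q A k) :=
      ((measurable_tailIntegral hcp).div (measurable_tailIntegral hp)).ennreal_toReal
    fun_prop
  have hMp : ∀ k, Measurable fun x =>
      ENNReal.ofReal (Real.exp (l * condCount μ Q A k x)) * p x := fun k => (hM k).mul hp
  obtain ⟨x₀⟩ : Nonempty (Fin n → Ω) := by
    by_contra h
    rw [not_nonempty_iff] at h
    have := measure_univ (μ := Q)
    simp [Measure.eq_zero_of_isEmpty] at this
  have hexp : ∀ k : ℕ, ∫⁻ x, ENNReal.ofReal (Real.exp (l * condCount μ Q A k x)) ∂Q =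
      ∫⁻ y, tailIntegral μ i (fun x => ENNReal.ofReal (Real.exp (l * condCount μ Q A k x)) * p x)
        (extendHead x₀ i y) ∂Measure.pi fun _ => μ := by
    intro k
    nth_rw 1 [← hQp]
    rw [lintegral_withDensity_eq_lintegral_mul _ hp (hM k),
      ← lintegral_eq_lintegral_extendHead (hMp k) x₀ i]
    exact lintegral_congr fun x => mul_comm _ _
  have hinv : ∀ k x, tailIntegral μ k
      (fun x => ENNReal.ofReal (Real.exp (l * condCount μ Q A k x)) * p x) x =
      ENNReal.ofReal (Real.exp (l * condCount μ Q A k x)) * tailIntegral μ k p x := fun k x =>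
    tailIntegral_mul_of_invariant hp
      (fun x y h => by rw [condCount_congr μ Q A h]) x
  have hfin : ∀ᵐ y ∂Measure.pi fun _ => μ, tailIntegral μ i p (extendHead x₀ i y) ≠ ∞ := by
    have h1 : ∫⁻ y, tailIntegral μ i p (extendHead x₀ i y) ∂Measure.pi (fun _ => μ) = 1 := by
      rw [← lintegral_eq_lintegral_extendHead hp, ← setLIntegral_univ, ← withDensity_apply _ .univ,
        hQp, measure_univ]
    have := ae_lt_top ((measurable_tailIntegral hp).comp (measurable_extendHead x₀ i))
      (h1.trans_ne ENNReal.one_ne_top)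
    filter_upwards [this] with y hy using hy.ne
  -- The essential supremum controls almost all triples; Fubini turns this into the iterated form
  -- that Hoeffding's lemma uses.
  have heta : ∀ᵐ y ∂Measure.pi fun _ => μ, ∀ᵐ w ∂μ, ∀ᵐ w' ∂μ, ∀ j, ∀ hij : i < j,
      margDensity μ Q i (concat i y w) ≠ 0 → margDensity μ Q i (concat i y w') ≠ 0 →
        eta μ Q hij y w w' ≤ etaBar μ Q hij := by
    have h := ae_all_iff.2 fun j : Fin n => ae_all_iff.2 fun hij : i < j =>
      ae_eta_le_etaBar μ Q hij
    filter_upwards [Measure.ae_ae_of_ae_prod h] with y hy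
    exact Measure.ae_ae_of_ae_prod hy
  rw [hexp, hexp, ← lintegral_const_mul' _ _ ENNReal.ofReal_ne_top]
  refine lintegral_mono_ae ?_
  filter_upwards [hfin, heta] with y hy hetay
  set X : Ω → Fin n → Ω := fun w => Function.update (extendHead x₀ i y) i w with hX
  have hXm : Measurable X := measurable_update _
  have hXc : ∀ w, (fun k : {k : Fin n // k ≤ i} => X w k) = concat i y w :=
    restrict_update_extendHead x₀ i y
  have hmarg : ∀ w, tailIntegral μ (i + 1) p (X w) = margDensity μ Q i (concat i y w) := fun w => by
    rw [tailIntegral_rnDeriv_eq_margDensity, hXc]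
  rw [hinv, tailIntegral_eq_lintegral_update (hMp _)]
  simp only [hinv]
  have hpi := tailIntegral_eq_lintegral_update (μ := μ) hp i (extendHead x₀ i y)
  rw [condCount, ← hpdef, tailIntegral_eq_lintegral_update (μ := μ) hcp i, hpi]
  rw [hpi] at hy
  have ham : Measurable fun w => tailIntegral μ (i + 1) p (X w) :=
    (measurable_tailIntegral hp).comp hXm
  have hHm : Measurable fun w => tailIntegral μ (i + 1) (fun x => count A x * p x) (X w) :=
    (measurable_tailIntegral hcp).comp hXm
  have hfin' : ∀ᵐ w ∂μ, margDensity μ Q i (concat i y w) ≠ ∞ := by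
    filter_upwards [ae_lt_top ham hy] with w hw
    rw [← hmarg]; exact hw.ne
  refine lintegral_exp_ratio_mul_le μ ham hHm hy (ENNReal.natCast_ne_top n) (fun w => ?_)
    (zero_le_one.trans (one_le_mixingNorm μ Q i)) ?_ l
  · refine (tailIntegral_mono (fun x => mul_le_mul_left (count_le A x) (p x)) _).trans_eq ?_
    exact tailIntegral_mul_of_invariant hp (fun _ _ _ => rfl) _
  · filter_upwards [hetay, hfin'] with w hw hwf
    filter_upwards [hw, hfin'] with w' hw' hwf' h0 h0'
    rw [hmarg] at h0 h0'
    exact abs_condCount_sub_le μ Q hA i (hXc w) (hXc w') h0 hwf h0' hwf'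
      fun j hij => hw' j hij h0 h0'

end Conditional

end EtaMixing

namespace EtaMixing

/-! ### Concentration around the mean -/

section Concentration

open ProbabilityTheory

variable {Ω : Type*} [MeasurableSpace Ω] {n : ℕ} (μ : Measure Ω) [SigmaFinite μ]
  (Q : Measure (Fin n → Ω)) [IsProbabilityMeasure Q]

theorem lintegral_exp_condCount_le {A : Set Ω} (hA : MeasurableSet A) (hQ : Q ≪ prodMeasure μ n)
    (l : ℝ) {k : ℕ} (hk : k ≤ n) :
    ∫⁻ x, ENNReal.ofReal (Real.exp (l * condCount μ Q A k x)) ∂Q ≤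
      ENNReal.ofReal (Real.exp (k * (mixingNorm μ Q ^ 2 * l ^ 2 / 2))) *
        ∫⁻ x, ENNReal.ofReal (Real.exp (l * condCount μ Q A 0 x)) ∂Q := by
  induction k with
  | zero => simp
  | succ k ih =>
    refine (lintegral_exp_condCount_succ_le μ Q hA hQ ⟨k, hk⟩ l).trans ?_
    refine (mul_le_mul_right (ih (Nat.le_of_succ_le hk)) _).trans_eq ?_
    rw [← mul_assoc, ← ENNReal.ofReal_mul (Real.exp_pos _).le, ← Real.exp_add]
    congr 3
    push_cast; ring

/-- The density is positive and finite `Q`-almost everywhere, so it cancels. -/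
theorem condCount_length_ae {A : Set Ω} (hQ : Q ≪ prodMeasure μ n) :
    ∀ᵐ x ∂Q, condCount μ Q A n x = (count A x).toReal := by
  have h1 : ∀ᵐ x ∂Q, Q.rnDeriv (prodMeasure μ n) x ≠ ∞ :=
    hQ.ae_le (Measure.rnDeriv_ne_top Q (prodMeasure μ n))
  have h2 : ∀ᵐ x ∂Q, 0 < Q.rnDeriv (prodMeasure μ n) x := Measure.rnDeriv_pos hQ
  filter_upwards [h1, h2] with x hx hx'
  rw [condCount, tailIntegral_length, tailIntegral_length,
    ENNReal.mul_div_cancel_right hx'.ne' hx]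

theorem condCount_zero {A : Set Ω} (hA : MeasurableSet A) (hQ : Q ≪ prodMeasure μ n)
    (x : Fin n → Ω) : condCount μ Q A 0 x = ∫ x, (count A x).toReal ∂Q := by
  have hp : Measurable (Q.rnDeriv (prodMeasure μ n)) := Measure.measurable_rnDeriv _ _
  have hQp : (prodMeasure μ n).withDensity (Q.rnDeriv (prodMeasure μ n)) = Q :=
    Measure.withDensity_rnDeriv_eq _ _ hQ
  have e1 : ∫⁻ x, Q.rnDeriv (prodMeasure μ n) x ∂prodMeasure μ n = 1 := by
    rw [← setLIntegral_univ, ← withDensity_apply _ .univ, hQp, measure_univ]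
  have e2 : ∫⁻ x, count A x * Q.rnDeriv (prodMeasure μ n) x ∂prodMeasure μ n =
      ∫⁻ x, count A x ∂Q := by
    conv_rhs => rw [← hQp]
    rw [lintegral_withDensity_eq_lintegral_mul _ hp (measurable_count hA)]
    exact lintegral_congr fun x => mul_comm _ _
  rw [condCount, tailIntegral_zero, tailIntegral_zero, e1, e2, div_one,
    integral_toReal (measurable_count hA).aemeasurable
      (Eventually.of_forall fun x => (count_le A x).trans_lt (ENNReal.natCast_lt_top n))]

theorem integrable_of_abs_le {S : Type*} [MeasurableSpace S] {α : Measure S} [IsFiniteMeasure α]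
    {f : S → ℝ} (hf : Measurable f) {c : ℝ} (hc : ∀ x, |f x| ≤ c) : Integrable f α :=
  Integrable.of_bound hf.aestronglyMeasurable c (Eventually.of_forall hc)

theorem hasSubgaussianMGF_count {A : Set Ω} (hA : MeasurableSet A) (hQ : Q ≪ prodMeasure μ n) :
    HasSubgaussianMGF (fun x => (count A x).toReal - ∫ x, (count A x).toReal ∂Q)
      (n * Real.toNNReal (mixingNorm μ Q ^ 2)) Q := by
  have hm : Measurable fun x : Fin n → Ω => (count A x).toReal := (measurable_count hA).ennreal_toReal
  set m := ∫ x, (count A x).toReal ∂Q with hmdef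
  have hb : ∀ x : Fin n → Ω, |(count A x).toReal| ≤ n := fun x => by
    rw [abs_of_nonneg ENNReal.toReal_nonneg]
    exact ENNReal.toReal_le_of_le_ofReal n.cast_nonneg (by simpa using count_le A x)
  have hint : ∀ l : ℝ, Integrable (fun x => Real.exp (l * ((count A x).toReal - m))) Q := by
    intro l
    refine integrable_of_abs_le (c := Real.exp (|l| * (n + |m|))) (by fun_prop) fun x => ?_
    rw [Real.abs_exp, Real.exp_le_exp]
    refine (le_abs_self _).trans ?_
    rw [abs_mul]
    gcongr
    exact (abs_sub _ _).trans (by gcongr; exact hb x)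
  refine ⟨hint, fun l => ?_⟩
  have h := lintegral_exp_condCount_le μ Q hA hQ l le_rfl
  simp only [condCount_zero μ Q hA hQ, ← hmdef, lintegral_const, measure_univ, mul_one] at h
  rw [lintegral_congr_ae (g := fun x => ENNReal.ofReal (Real.exp (l * (count A x).toReal))) (by
    filter_upwards [condCount_length_ae μ Q (A := A) hQ] with x hx
    rw [hx])] at h
  have hint' : Integrable (fun x => Real.exp (l * (count A x).toReal)) Q := by
    have := (hint l).const_mul (Real.exp (l * m))
    refine this.congr (Eventually.of_forall fun x => ?_)
    simp only
    rw [← Real.exp_add]; congr 1; ring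
  rw [← ofReal_integral_eq_lintegral_ofReal hint' (Eventually.of_forall fun x => (Real.exp_pos _).le),
    ← ENNReal.ofReal_mul (Real.exp_pos _).le, ENNReal.ofReal_le_ofReal_iff (by positivity)] at h
  have e : mgf (fun x => (count A x).toReal - m) Q l =
      Real.exp (-(l * m)) * ∫ x, Real.exp (l * (count A x).toReal) ∂Q := by
    rw [mgf, ← integral_const_mul]
    congr 1
    funext x
    rw [← Real.exp_add]; ring_nf
  rw [e]
  refine (mul_le_mul_of_nonneg_left h (Real.exp_pos _).le).trans_eq ?_
  rw [← Real.exp_add, ← Real.exp_add, NNReal.coe_mul, Real.coe_toNNReal _ (sq_nonneg _)]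
  push_cast
  ring_nf

theorem measurable_empirical {A : Set Ω} (hA : MeasurableSet A) :
    Measurable fun x : Fin n → Ω => empirical x A := by
  simp only [empirical_eq_count]
  exact (measurable_count hA).ennreal_toReal.const_mul _

/-- Concentration of the empirical measure of a set around its expectation. -/
theorem measureReal_abs_empirical_sub_ge_le {A : Set Ω} (hA : MeasurableSet A)
    (hQ : Q ≪ prodMeasure μ n) (hn : 0 < n) {t : ℝ} (ht : 0 < t) :
    Q.real {x | t ≤ |empirical x A - ∫ x, empirical x A ∂Q|} ≤
      2 * Real.exp (-(n * t ^ 2 / (2 * mixingNorm μ Q ^ 2))) := by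
  have hR : 0 < mixingNorm μ Q := zero_lt_one.trans_le (one_le_mixingNorm μ Q ⟨0, hn⟩)
  have hn' : (0 : ℝ) < n := Nat.cast_pos.2 hn
  have hs := hasSubgaussianMGF_count μ Q hA hQ
  -- A deviation `t` of the empirical measure is a deviation `n t` of the count; one factor `n`
  -- cancels against the parameter.
  have e : -((n * t) ^ 2) / (2 * ((n * Real.toNNReal (mixingNorm μ Q ^ 2) : NNReal) : ℝ)) =
      -(n * t ^ 2 / (2 * mixingNorm μ Q ^ 2)) := by
    rw [NNReal.coe_mul, Real.coe_toNNReal _ (sq_nonneg _)]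
    push_cast
    field_simp
  have h1 := hs.measure_ge_le (mul_pos hn' ht).le
  have h2 := hs.neg.measure_ge_le (mul_pos hn' ht).le
  rw [e] at h1 h2
  have hsub : {x : Fin n → Ω | t ≤ |empirical x A - ∫ x, empirical x A ∂Q|} ⊆
      {x | n * t ≤ (count A x).toReal - ∫ x, (count A x).toReal ∂Q} ∪
        {x | n * t ≤ (-fun x : Fin n → Ω => (count A x).toReal - ∫ x, (count A x).toReal ∂Q) x} := by
    intro x hx
    simp only [Set.mem_ofPred_eq, empirical_eq_count, integral_const_mul] at hx
    rw [← mul_sub, abs_mul, abs_of_pos (by positivity), one_div, inv_mul_eq_div,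
      le_div_iff₀ hn', mul_comm] at hx
    rcases le_abs.1 hx with h | h
    · exact Or.inl h
    · exact Or.inr h
  refine (measureReal_mono hsub).trans ((measureReal_union_le _ _).trans ?_)
  linarith

end Concentration

/-! ### Elementary properties of the empirical measure -/

section Empirical

variable {Ω : Type*} {n : ℕ}

theorem abs_empirical_le_one (x : Fin n → Ω) (A : Set Ω) : |empirical x A| ≤ 1 := by
  have h : (count A x).toReal ≤ n :=
    ENNReal.toReal_le_of_le_ofReal n.cast_nonneg (by simpa using count_le A x)
  rw [empirical_eq_count, one_div, inv_mul_eq_div, abs_of_nonneg (by positivity)]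
  exact div_le_one_of_le₀ h n.cast_nonneg

theorem empirical_compl (hn : 0 < n) (x : Fin n → Ω) (A : Set Ω) :
    empirical x Aᶜ = 1 - empirical x A := by
  have hn' : (n : ℝ) ≠ 0 := by positivity
  have : ∀ i, Aᶜ.indicator (fun _ => (1 : ℝ)) (x i) = 1 - A.indicator (fun _ => (1 : ℝ)) (x i) := by
    intro i
    by_cases h : x i ∈ A <;> simp [h]
  simp only [empirical, this, Finset.sum_sub_distrib]
  simp
  field_simp

end Empirical

/-! ### Bias, deviation from the limit, and Borel–Cantelli -/

section Bias

variable {Ω : Type*} [MeasurableSpace Ω]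

theorem measurable_firstTerms (n : ℕ) : Measurable (firstTerms n : (ℕ → Ω) → Fin n → Ω) :=
  measurable_pi_lambda _ fun _ => measurable_pi_apply _

variable (P : Measure (ℕ → Ω)) [IsProbabilityMeasure P] (ν : Measure Ω) [IsFiniteMeasure ν]

instance isProbabilityMeasure_marginal (n : ℕ) : IsProbabilityMeasure (marginal P n) :=
  Measure.isProbabilityMeasure_map (measurable_firstTerms n).aemeasurable

theorem abs_integral_empirical_sub_le (n : ℕ) (A : Set Ω) :
    |(∫ x, empirical x A ∂marginal P n) - ν.real A| ≤ 1 + ν.real Set.univ := by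
  have h1 : |∫ x, empirical x A ∂marginal P n| ≤ 1 := by
    simpa using norm_integral_le_of_norm_le_const (μ := marginal P n)
      (f := fun x => empirical x A)
      (C := 1) (Eventually.of_forall fun x => abs_empirical_le_one x A)
  have h2 : |ν.real A| ≤ ν.real Set.univ := by
    rw [abs_of_nonneg measureReal_nonneg]
    exact measureReal_mono (Set.subset_univ _)
  exact (abs_sub _ _).trans (add_le_add h1 h2)

variable {ν}

/-- Comparing the values on the whole space and on `∅` bounds the mass defect by twice the bias, for
`n > 0`. -/
theorem measureReal_univ_eq_one_of_tendsto_bias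
    (hν : Tendsto (fun n : ℕ => bias P ν n) atTop (𝓝 0)) : ν.real Set.univ = 1 := by
  have h : ∀ n, 0 < n → |1 - ν.real Set.univ| ≤ 2 * bias P ν n := by
    intro n hn
    have hu : ∀ x : Fin n → Ω, empirical x Set.univ = 1 := fun x => by
      have : (n : ℝ) ≠ 0 := by positivity
      simp [empirical, this]
    have he : ∀ x : Fin n → Ω, empirical x ∅ = 0 := fun x => by simp [empirical]
    have h1 := le_two_mul_tvNorm (abs_integral_empirical_sub_le P ν n) .univ .empty
    have h2 := le_two_mul_tvNorm (abs_integral_empirical_sub_le P ν n) .empty .univ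
    simp only [hu, he, integral_const, probReal_univ, smul_eq_mul, mul_one, mul_zero,
      measureReal_empty] at h1 h2
    rw [abs_le, bias]
    constructor <;> linarith
  have h0 : |1 - ν.real Set.univ| ≤ 2 * 0 :=
    ge_of_tendsto (hν.const_mul 2) (by filter_upwards [eventually_gt_atTop 0] with n hn using h n hn)
  have := abs_nonpos_iff.1 (h0.trans_eq (mul_zero 2))
  linarith

theorem abs_integral_empirical_sub_le_bias (hν : ν.real Set.univ = 1) {n : ℕ} (hn : 0 < n)
    {A : Set Ω} (hA : MeasurableSet A) :
    |(∫ x, empirical x A ∂marginal P n) - ν.real A| ≤ bias P ν n := by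
  refine abs_le_tvNorm (σ := fun A => (∫ x, empirical x A ∂marginal P n) - ν.real A)
    (abs_integral_empirical_sub_le P ν n) (fun B hB => ?_) hA
  simp only [empirical_compl hn]
  rw [integral_sub (integrable_const _) (integrable_of_abs_le (measurable_empirical hB)
    fun x => abs_empirical_le_one x B), measureReal_compl hB, hν]
  simp

theorem marginal_abs_empirical_sub_gt_le (μ : Measure Ω) [SigmaFinite μ]
    (hν : ν.real Set.univ = 1) {n : ℕ} (hn : 0 < n) (hP : marginal P n ≪ prodMeasure μ n)
    {A : Set Ω} (hA : MeasurableSet A) {t ε : ℝ} (ht : 0 < t) (hε : bias P ν n < ε) :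
    (marginal P n).real {x | t + ε < |empirical x A - ν.real A|} ≤
      2 * Real.exp (-(n * t ^ 2 / (2 * mixingNorm μ (marginal P n) ^ 2))) := by
  refine (measureReal_mono fun x hx => ?_).trans
    (measureReal_abs_empirical_sub_ge_le μ (marginal P n) hA hP hn ht)
  have h1 := abs_integral_empirical_sub_le_bias P hν hn hA
  have h2 := abs_sub_le (empirical x A) (∫ x, empirical x A ∂marginal P n) (ν.real A)
  simp only [Set.mem_ofPred_eq] at hx ⊢
  linarith

/-- Borel–Cantelli applied to the deviation bound with `ε = t`. -/
theorem ae_eventually_abs_empirical_sub_le (μ : Measure Ω) [SigmaFinite μ]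
    (hP : ∀ n : ℕ, 1 ≤ n → marginal P n ≪ prodMeasure μ n)
    (hν : Tendsto (fun n : ℕ => bias P ν n) atTop (𝓝 0)) {A : Set Ω} (hA : MeasurableSet A)
    {t : ℝ} (ht : 0 < t) (hsum : Summable fun n : ℕ =>
      Real.exp (-((n : ℝ) * t ^ 2 / (2 * mixingNorm μ (marginal P n) ^ 2)))) :
    ∀ᵐ ω ∂P, ∀ᶠ n : ℕ in atTop, |empirical (firstTerms n ω) A - ν.real A| ≤ t + t := by
  have hν1 := measureReal_univ_eq_one_of_tendsto_bias P hν
  obtain ⟨n₀, hn₀⟩ := eventually_atTop.1 (hν.eventually_lt_const ht)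
  -- The shift makes every index positive and past the point where the bias is below `t`.
  set N := n₀ + 1
  have hset : ∀ n : ℕ, MeasurableSet {x : Fin n → Ω | t + t < |empirical x A - ν.real A|} :=
    fun n => measurableSet_lt measurable_const ((measurable_empirical hA).sub_const _).abs
  have hle : ∀ n, P {ω | t + t < |empirical (firstTerms (n + N) ω) A - ν.real A|} ≤
      ENNReal.ofReal (2 * Real.exp (-(((n + N : ℕ) : ℝ) * t ^ 2 /
        (2 * mixingNorm μ (marginal P (n + N)) ^ 2)))) := by
    intro n
    have h := marginal_abs_empirical_sub_gt_le P μ hν1 (n := n + N) (by omega)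
      (hP _ (by omega)) hA ht (hn₀ _ (by omega))
    rw [← ENNReal.ofReal_le_ofReal_iff (by positivity), ofReal_measureReal] at h
    rwa [marginal, Measure.map_apply (measurable_firstTerms _) (hset _)] at h
  have htsum : ∑' n, P {ω | t + t < |empirical (firstTerms (n + N) ω) A - ν.real A|} ≠ ∞ :=
    ne_top_of_le_ne_top (((summable_nat_add_iff N).2 hsum).mul_left 2).tsum_ofReal_ne_top
      (ENNReal.tsum_le_tsum hle)
  filter_upwards [ae_eventually_notMem htsum] with ω hω
  obtain ⟨n₁, hn₁⟩ := eventually_atTop.1 hω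
  filter_upwards [eventually_ge_atTop (n₁ + N)] with n hn
  have := hn₁ (n - N) (by omega)
  rw [Nat.sub_add_cancel (by omega)] at this
  exact not_lt.1 this

end Bias

end EtaMixing

theorem theorem4p1 {Ω : Type*} [MeasurableSpace Ω]
    (μ : Measure Ω) [SigmaFinite μ]
    (hΨ : ∀ n : ℕ, 1 ≤ n → EtaMixing.IsPsiDominated μ n EtaMixing.hamming)
    (P : Measure (ℕ → Ω)) [IsProbabilityMeasure P]
    (hP : ∀ n : ℕ, 1 ≤ n → EtaMixing.marginal P n ≪ EtaMixing.prodMeasure μ n)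
    (ν : Measure Ω) [IsFiniteMeasure ν]
    (hν : Tendsto (fun n : ℕ => EtaMixing.bias P ν n) atTop (𝓝 0)) :
    (∀ (ε : ℝ) (n₀ : ℕ), (∀ n : ℕ, n₀ < n → EtaMixing.bias P ν n < ε) →
      ∀ A : Set Ω, MeasurableSet A → ∀ t : ℝ, 0 < t → ∀ n : ℕ, n₀ < n →
        (EtaMixing.marginal P n).real
            {x | t + ε < |EtaMixing.empirical x A - ν.real A|} ≤
          2 * Real.exp (-((n : ℝ) * t ^ 2 /
            (2 * EtaMixing.mixingNorm μ (EtaMixing.marginal P n) ^ 2)))) ∧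
    ((∀ t : ℝ, 0 < t → Summable fun n : ℕ => Real.exp (-((n : ℝ) * t ^ 2 /
        (2 * EtaMixing.mixingNorm μ (EtaMixing.marginal P n) ^ 2)))) →
      ∀ A : Set Ω, MeasurableSet A → ∀ᵐ ω ∂P,
        Tendsto (fun n : ℕ => EtaMixing.empirical (EtaMixing.firstTerms n ω) A)
          atTop (𝓝 (ν.real A))) := by

  have hν1 := EtaMixing.measureReal_univ_eq_one_of_tendsto_bias P hν
  refine ⟨fun ε n₀ hε A hA t ht n hn => ?_, fun hsum A hA => ?_⟩
  · exact EtaMixing.marginal_abs_empirical_sub_gt_le P μ hν1 (Nat.zero_lt_of_lt hn)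
      (hP n (Nat.zero_lt_of_lt hn)) hA ht (hε n hn)
  -- Countably many thresholds, so that one null set serves for all of them.
  · have h : ∀ᵐ ω ∂P, ∀ m : ℕ, ∀ᶠ n : ℕ in atTop,
        |EtaMixing.empirical (EtaMixing.firstTerms n ω) A - ν.real A| ≤
          1 / ((m : ℝ) + 1) + 1 / ((m : ℝ) + 1) :=
      ae_all_iff.2 fun m => EtaMixing.ae_eventually_abs_empirical_sub_le P μ hP hν hA
        Nat.one_div_pos_of_nat (hsum _ Nat.one_div_pos_of_nat)
    filter_upwards [h] with ω hω
    rw [Metric.tendsto_nhds]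
    intro δ hδ
    obtain ⟨m, hm⟩ := exists_nat_one_div_lt (half_pos hδ)
    filter_upwards [hω m] with n hn
    rw [Real.dist_eq]
    linarith
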